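/- Let $n\ge 0$ and let $SU_{\rm loc}(2^n)=\{U_1\otimes\cdots\otimes U_n : U_\ell\in SU(2)\}$. For $A,C\in \mathrm{Mat}_{2^n}(\mathbb C)$ let $$W_{\rm loc}(C,A)=\{\operatorname{tr}(C^\dagger KAK^\dagger) : K\in SU_{\rm loc}(2^n)\}$$ be the local $C$-numerical range of $A$. Call $A$ locally sign-reversible if $KAK^\dagger=-A$ for some $K\in SU_{\rm loc}(2^n)$, call a set $S\subseteq\mathbb C$ rotationally symmetric if $e^{i\theta}S\subseteq S$ for all real $\theta$, and let $\|\cdot\|_2$ be the Frobenius norm. Discs are closed and may have radius $0$. 1. Let $A_+\in \mathrm{Mat}_{2^n}(\mathbb C)$ and $A_-:=A_+^\dagger$ be such that, for every $C\in \mathrm{Mat}_{2^n}(\mathbb C)$, both $W_{\rm loc}(C,A_+)$ and $W_{\rm loc}(C,A_-)$ are circular discs centred at $0$. Then there is a $K\in SU_{\rm loc}(2^n)$ with $K(A_++\lambda A_-)K^\dagger=-(A_++\lambda A_-)$ for all $\lambda\in\mathbb C$. In particular the Hermitian matrix $H:=A_++A_-$ is locally sign-reversible, and $W_{\rm loc}(H,H)$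 is the real interval $[-\|H\|_2^2,\,\|H\|_2^2]$. 2. The converse fails in general: for some $n$ there is a locally sign-reversible Hermitian $H\in\mathrm{Mat}_{2^n}(\mathbb C)$ that cannot be written as $H=H_++H_-$ with $H_-=H_+^\dagger$ and with $W_{\rm loc}(C,H_+)$ and $W_{\rm loc}(C,H_-)$ rotationally symmetric for every $C$. 3. Every locally sign-reversible Hermitian $H\in\mathrm{Mat}_{2^n}(\mathbb C)$ can be written as $H=\sum_{\ell=1}^m\big(H_+^{(\ell)}+H_-^{(\ell)}\big)$ with $m\le\binom{2^n}{2}$ and $H_-^{(\ell)}=(H_+^{(\ell)})^\dagger$, such that for every $\ell$ and every $C\in\mathrm{Mat}_{2^n}(\mathbb C)$ one has $W_{\rm loc}(C,H_+^{(\ell)})=W_{\rm loc}(C,H_-^{(\ell)})$, and this set is rotationally symmetric and is in fact a circular disc centred at $0$. -/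

import Mathlib

namespace LocalNumericalRange

/-- Computational basis labels of `n` qubits; there are `2 ^ n` of them. -/
abbrev Qubits (n : ℕ) : Type := Fin n → Fin 2

/-- The complex matrices of size `2 ^ n`, with rows and columns labelled by the
computational basis. -/
abbrev QMat (n : ℕ) : Type := Matrix (Qubits n) (Qubits n) ℂ

/-- The tensor (Kronecker) product `U 0 ⊗ U 1 ⊗ ⋯ ⊗ U (n - 1)` of `2 × 2` matrices. -/
def tensor {n : ℕ} (U : Fin n → Matrix (Fin 2) (Fin 2) ℂ) : QMat n :=
  Matrix.of fun i j => ∏ l, U l (i l) (j l)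

/-- The local unitary operations `SU(2) ⊗ ⋯ ⊗ SU(2)`. -/
def SUloc (n : ℕ) : Set (QMat n) :=
  {K | ∃ U : Fin n → Matrix (Fin 2) (Fin 2) ℂ,
    (∀ l, U l ∈ Matrix.specialUnitaryGroup (Fin 2) ℂ) ∧ K = tensor U}

/-- The local `C`-numerical range `{tr (C† K A K†) | K ∈ SUloc n}` of `A`. -/
def Wloc {n : ℕ} (C A : QMat n) : Set ℂ :=
  {z | ∃ K ∈ SUloc n, z = (C.conjTranspose * (K * A * K.conjTranspose)).trace}

/-- `A` is sign-reversible by a local unitary operation. -/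
def LocallySignReversible {n : ℕ} (A : QMat n) : Prop :=
  ∃ K ∈ SUloc n, K * A * K.conjTranspose = -A

/-- `S` is a closed circular disc centred at the origin; radius `0` is allowed, since
`Wloc 0 A = {0}`. -/
def IsCentredDisc (S : Set ℂ) : Prop :=
  ∃ r : ℝ, 0 ≤ r ∧ S = Metric.closedBall 0 r

/-- `S` is invariant under all rotations about the origin. -/
def IsRotationallySymmetric (S : Set ℂ) : Prop :=
  ∀ u : ℂ, ‖u‖ = 1 → ∀ z ∈ S, u * z ∈ S

/-- The Frobenius (Hilbert–Schmidt) norm. -/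
noncomputable def frobNorm {n : ℕ} (A : QMat n) : ℝ :=
  (Matrix.frobeniusNormedAddCommGroup : NormedAddCommGroup (QMat n)).toNorm.norm A

end LocalNumericalRange

/-! Local conjugation preserves the Frobenius norm, so `Wloc A A` lies in the disc of radius `‖A‖²`
and contains `‖A‖²` itself. If it also contains `u‖A‖²` with `|u| = 1`, the equality case of
Cauchy–Schwarz turns the scalar statement into an orbit statement, `K A K† = u A`
(`exists_conj_eq_smul`). For part 1, take `C = A` and `u = -1`; adjoints give the same for `A†`. The
interval follows from Cauchy–Schwarz and connectedness of `SUloc n`.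

Part 2 uses `H = X₁ + X₂ + X₃ + X₁X₂X₃`. If `H = P + P†` with `Wloc P P` rotationally symmetric,
then for each `u` some local conjugate of `H` equals `uP + ūP†`, so all its correlations are first
harmonics in `u`. The single-qubit correlations are maximal at `u = 1`, hence proportional to `Re
u`; the three-qubit one is their product, a cubic in `Re u`, which is not a first harmonic.

For part 3, the sign-reversing `K` is diagonal in a local basis, and conjugation by a diagonal
unitary fixes diagonal entries, so in that basis `H` has zero diagonal. It is thus a sum of pairs of
off-diagonal matrix units. Local phases rotate such a unit, local flips exchange it with its adjoint
up to phase, and Schur triangularisation on one qubit puts `0` in its range; with compactness and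
connectedness this gives a disc. -/

open Matrix

namespace LocalNumericalRange

/-! ### Cauchy–Schwarz for the Hilbert–Schmidt inner product. -/

section Trace

variable {ι : Type*} [Fintype ι]

lemma trace_conjTranspose_mul_self_eq_sum (A : Matrix ι ι ℂ) :
    (Aᴴ * A).trace = ((∑ i, ∑ j, ‖A i j‖ ^ 2 : ℝ) : ℂ) := by
  rw [Finset.sum_comm]
  simp only [Matrix.trace, Matrix.diag, Matrix.mul_apply, Matrix.conjTranspose_apply,
    Complex.ofReal_sum]
  refine Finset.sum_congr rfl fun i _ => Finset.sum_congr rfl fun j _ => ?_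
  simpa using Complex.conj_mul' (A j i)

lemma trace_conjTranspose_mul_self_re_nonneg (A : Matrix ι ι ℂ) : 0 ≤ (Aᴴ * A).trace.re := by
  rw [trace_conjTranspose_mul_self_eq_sum, Complex.ofReal_re]
  positivity

lemma trace_conjTranspose_mul_self_im (A : Matrix ι ι ℂ) : (Aᴴ * A).trace.im = 0 := by
  rw [trace_conjTranspose_mul_self_eq_sum, Complex.ofReal_im]

lemma trace_conjTranspose_mul_comm (A B : Matrix ι ι ℂ) :
    (Bᴴ * A).trace = star (Aᴴ * B).trace := by
  rw [← Matrix.trace_conjTranspose, Matrix.conjTranspose_mul, Matrix.conjTranspose_conjTranspose]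

/-- Equality case of the Cauchy–Schwarz inequality for the Hilbert–Schmidt inner product. -/
lemma eq_smul_of_trace_eq {A B : Matrix ι ι ℂ} {u : ℂ} (hu : ‖u‖ = 1)
    (hAB : (Bᴴ * B).trace = (Aᴴ * A).trace) (h : (Aᴴ * B).trace = u * (Aᴴ * A).trace) :
    B = u • A := by
  have huu : star u * u = 1 := by simpa [hu] using Complex.conj_mul' u
  have hBA : (Bᴴ * A).trace = star u * (Aᴴ * A).trace := by
    have hself : star (Aᴴ * A).trace = (Aᴴ * A).trace := (trace_conjTranspose_mul_comm A A).symm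
    rw [trace_conjTranspose_mul_comm, h, star_mul', hself]
  have h0 : ((B - u • A)ᴴ * (B - u • A)).trace = 0 := by
    simp only [Matrix.conjTranspose_sub, Matrix.conjTranspose_smul, sub_mul, mul_sub,
      Matrix.trace_sub, Matrix.smul_mul, Matrix.mul_smul, Matrix.trace_smul, smul_eq_mul,
      hAB, h, hBA]
    linear_combination (-(Aᴴ * A).trace) * huu
  open scoped ComplexOrder in
  exact sub_eq_zero.mp (Matrix.trace_conjTranspose_mul_self_eq_zero_iff.mp h0)

/-- Expanding `‖A ± B‖² ≥ 0` for matrices of equal norm gives the two bounds. -/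
lemma abs_re_trace_le {A B : Matrix ι ι ℂ} (hAB : (Bᴴ * B).trace = (Aᴴ * A).trace) :
    |(Aᴴ * B).trace.re| ≤ (Aᴴ * A).trace.re := by
  have hBA : (Bᴴ * A).trace.re = (Aᴴ * B).trace.re := by
    rw [trace_conjTranspose_mul_comm]; simp
  have h₁ := trace_conjTranspose_mul_self_re_nonneg (A + B)
  have h₂ := trace_conjTranspose_mul_self_re_nonneg (A - B)
  simp only [Matrix.conjTranspose_add, Matrix.conjTranspose_sub, add_mul, mul_add, sub_mul,
    mul_sub, Matrix.trace_add, Matrix.trace_sub, Complex.add_re, Complex.sub_re, hAB, hBA] at h₁ h₂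
  rw [abs_le]
  constructor <;> linarith

lemma im_trace_eq_zero {A B : Matrix ι ι ℂ} (hA : A.IsHermitian) (hB : B.IsHermitian) :
    (A * B).trace.im = 0 := by
  have h := trace_conjTranspose_mul_comm A B
  rw [hA.eq, hB.eq, Matrix.trace_mul_comm] at h
  have := congrArg Complex.im h
  simp at this
  linarith

variable [DecidableEq ι]

lemma conj_trace_self {K : Matrix ι ι ℂ} (hK : Kᴴ * K = 1) (A : Matrix ι ι ℂ) :
    ((K * A * Kᴴ)ᴴ * (K * A * Kᴴ)).trace = (Aᴴ * A).trace := by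
  have h : (K * A * Kᴴ)ᴴ * (K * A * Kᴴ) = K * (Aᴴ * A * Kᴴ) := by
    simp only [Matrix.conjTranspose_mul, Matrix.conjTranspose_conjTranspose]
    calc K * (Aᴴ * Kᴴ) * (K * A * Kᴴ) = K * (Aᴴ * (Kᴴ * K) * A * Kᴴ) := by noncomm_ring
      _ = _ := by rw [hK, mul_one]
  rw [h, Matrix.trace_mul_comm, mul_assoc, hK, mul_one]

end Trace

lemma frobNorm_sq {n : ℕ} (A : QMat n) : frobNorm A ^ 2 = (Aᴴ * A).trace.re := by
  let _ : NormedAddCommGroup (QMat n) := Matrix.frobeniusNormedAddCommGroup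
  have h : frobNorm A = (∑ i, ∑ j, ‖A i j‖ ^ (2 : ℝ)) ^ (1 / 2 : ℝ) :=
    Matrix.frobenius_norm_def A
  rw [h, ← Real.sqrt_eq_rpow, Real.sq_sqrt (by positivity), trace_conjTranspose_mul_self_eq_sum,
    Complex.ofReal_re]
  simp

/-! ### Topology and triangularisation in `SU(2)`. -/

section SpecialUnitary

/-- The matrix with first column `(a, b)` that lies in `SU(2)` when `(a, b)` is a unit vector. -/
def suMatrix (a b : ℂ) : Matrix (Fin 2) (Fin 2) ℂ := !![a, -star b; b, star a]

lemma suMatrix_mem {a b : ℂ} (h : ‖a‖ ^ 2 + ‖b‖ ^ 2 = 1) :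
    suMatrix a b ∈ Matrix.specialUnitaryGroup (Fin 2) ℂ := by
  have h' : a * star a + b * star b = 1 := by
    have ha : a * star a = (‖a‖ : ℂ) ^ 2 := Complex.mul_conj' a
    have hb : b * star b = (‖b‖ : ℂ) ^ 2 := Complex.mul_conj' b
    rw [ha, hb]; exact_mod_cast h
  rw [Matrix.mem_specialUnitaryGroup_iff, Matrix.mem_unitaryGroup_iff, suMatrix,
    Matrix.det_fin_two_of]
  refine ⟨?_, by linear_combination h'⟩
  ext i j
  fin_cases i <;> fin_cases j <;>
    simp [Matrix.mul_apply, Fin.sum_univ_two, Matrix.star_eq_conjTranspose] <;>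
    simp only [Complex.star_def] at h' <;>
    first | ring1 | linear_combination h'

/-- Unitarity and determinant one make the conjugate transpose equal to the adjugate, so the first
column determines the second. -/
lemma exists_eq_suMatrix {U : Matrix (Fin 2) (Fin 2) ℂ}
    (hU : U ∈ Matrix.specialUnitaryGroup (Fin 2) ℂ) :
    ∃ a b : ℂ, ‖a‖ ^ 2 + ‖b‖ ^ 2 = 1 ∧ U = suMatrix a b := by
  rw [Matrix.mem_specialUnitaryGroup_iff] at hU
  obtain ⟨hu, hd⟩ := hU
  have hadj : Uᴴ = U.adjugate := by
    have h1 : Uᴴ * U = 1 := Matrix.mem_unitaryGroup_iff'.mp hu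
    calc Uᴴ = Uᴴ * (U * U.adjugate) := by rw [Matrix.mul_adjugate, hd, one_smul, mul_one]
      _ = U.adjugate := by rw [← mul_assoc, h1, one_mul]
  rw [Matrix.adjugate_fin_two] at hadj
  have h00 : star (U 0 0) = U 1 1 := by simpa using congrFun (congrFun hadj 0) 0
  have h01 : star (U 1 0) = -U 0 1 := by simpa using congrFun (congrFun hadj 0) 1
  refine ⟨U 0 0, U 1 0, ?_, ?_⟩
  · rw [Matrix.det_fin_two, ← h00, ← neg_neg (U 0 1), ← h01] at hd
    have ha : U 0 0 * star (U 0 0) = (‖U 0 0‖ : ℂ) ^ 2 := Complex.mul_conj' _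
    have hb : U 1 0 * star (U 1 0) = (‖U 1 0‖ : ℂ) ^ 2 := Complex.mul_conj' _
    have : (‖U 0 0‖ : ℂ) ^ 2 + (‖U 1 0‖ : ℂ) ^ 2 = 1 := by
      rw [← ha, ← hb]; linear_combination hd
    exact_mod_cast this
  · ext i j
    fin_cases i <;> fin_cases j
    · simp [suMatrix]
    · simpa [suMatrix, neg_eq_iff_eq_neg] using (congrArg Neg.neg h01).symm
    · simp [suMatrix]
    · simpa [suMatrix] using h00.symm

lemma conjTranspose_mem_specialUnitaryGroup {U : Matrix (Fin 2) (Fin 2) ℂ}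
    (hU : U ∈ Matrix.specialUnitaryGroup (Fin 2) ℂ) :
    Uᴴ ∈ Matrix.specialUnitaryGroup (Fin 2) ℂ :=
  (star (⟨U, hU⟩ : Matrix.specialUnitaryGroup (Fin 2) ℂ)).2

lemma conjTranspose_mul_self_of_mem {U : Matrix (Fin 2) (Fin 2) ℂ}
    (hU : U ∈ Matrix.specialUnitaryGroup (Fin 2) ℂ) : Uᴴ * U = 1 :=
  Matrix.mem_unitaryGroup_iff'.mp (Matrix.mem_specialUnitaryGroup_iff.mp hU).1

/-- Identifying `SU(2)` with the unit sphere of `ℂ²` supplies both compactness and connectedness. -/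
lemma specialUnitaryGroup_eq_image :
    (Matrix.specialUnitaryGroup (Fin 2) ℂ : Set (Matrix (Fin 2) (Fin 2) ℂ)) =
      (fun v : EuclideanSpace ℂ (Fin 2) => suMatrix (v 0) (v 1)) '' Metric.sphere 0 1 := by
  have hs : ∀ v : EuclideanSpace ℂ (Fin 2),
      v ∈ Metric.sphere 0 1 ↔ ‖v 0‖ ^ 2 + ‖v 1‖ ^ 2 = 1 := fun v => by
    rw [mem_sphere_zero_iff_norm, EuclideanSpace.norm_eq, Fin.sum_univ_two, Real.sqrt_eq_one]
  ext U
  constructor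
  · intro hU
    obtain ⟨a, b, hab, rfl⟩ := exists_eq_suMatrix hU
    exact ⟨!₂[a, b], (hs _).2 (by simpa using hab), by simp⟩
  · rintro ⟨v, hv, rfl⟩
    exact suMatrix_mem ((hs v).1 hv)

lemma continuous_suMatrix :
    Continuous fun v : EuclideanSpace ℂ (Fin 2) => suMatrix (v 0) (v 1) := by
  unfold suMatrix
  refine continuous_matrix fun i j => ?_
  fin_cases i <;> fin_cases j <;> simp <;> fun_prop

lemma isCompact_specialUnitaryGroup :
    IsCompact (Matrix.specialUnitaryGroup (Fin 2) ℂ : Set (Matrix (Fin 2) (Fin 2) ℂ)) := by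
  rw [specialUnitaryGroup_eq_image]
  exact (isCompact_sphere _ _).image continuous_suMatrix

lemma isPreconnected_specialUnitaryGroup :
    IsPreconnected (Matrix.specialUnitaryGroup (Fin 2) ℂ : Set (Matrix (Fin 2) (Fin 2) ℂ)) := by
  rw [specialUnitaryGroup_eq_image]
  refine (isPreconnected_sphere ?_ _ _).image _ continuous_suMatrix.continuousOn
  -- The sphere is connected because `ℂ²` has real dimension `4 > 1`.
  rw [← Module.finrank_eq_rank, ← Nat.cast_one, Nat.cast_lt,
    ← Module.finrank_mul_finrank ℝ ℂ (EuclideanSpace ℂ (Fin 2))]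
  simp

/-- Schur triangularisation of a `2 × 2` matrix by an element of `SU(2)`. -/
lemma exists_triangular (M : Matrix (Fin 2) (Fin 2) ℂ) :
    ∃ V ∈ Matrix.specialUnitaryGroup (Fin 2) ℂ, (Vᴴ * M * V) 1 0 = 0 := by
  obtain ⟨μ, hμ⟩ := Module.End.exists_eigenvalue (Matrix.toLin' M)
  obtain ⟨v, hv⟩ := hμ.exists_hasEigenvector
  have hMv : M *ᵥ v = μ • v := by simpa using hv.apply_eq_smul
  have h0 := congrFun hMv 0
  have h1 := congrFun hMv 1
  simp only [Matrix.mulVec, dotProduct, Fin.sum_univ_two, Pi.smul_apply, smul_eq_mul] at h0 h1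
  have hpos : 0 < ‖v 0‖ ^ 2 + ‖v 1‖ ^ 2 := by
    by_contra hn
    have e0 : ‖v 0‖ = 0 := by nlinarith [sq_nonneg ‖v 0‖, sq_nonneg ‖v 1‖]
    have e1 : ‖v 1‖ = 0 := by nlinarith [sq_nonneg ‖v 0‖, sq_nonneg ‖v 1‖]
    refine hv.2 (funext fun i => ?_)
    fin_cases i
    · simpa using e0
    · simpa using e1
  set r : ℝ := Real.sqrt (‖v 0‖ ^ 2 + ‖v 1‖ ^ 2)
  have hr : 0 < r := Real.sqrt_pos.2 hpos
  have hr2 : r ^ 2 = ‖v 0‖ ^ 2 + ‖v 1‖ ^ 2 := Real.sq_sqrt hpos.le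
  refine ⟨suMatrix ((r : ℂ)⁻¹ * v 0) ((r : ℂ)⁻¹ * v 1), suMatrix_mem ?_, ?_⟩
  · simp only [norm_mul, norm_inv, Complex.norm_real, Real.norm_eq_abs, abs_of_pos hr]
    field_simp
    exact hr2.symm
  · simp [suMatrix, Matrix.mul_apply, Fin.sum_univ_two]
    -- The lower-left entry is `r⁻² (v₀ (Mv)₁ - v₁ (Mv)₀)`, which vanishes on an eigenvector.
    linear_combination (r : ℂ)⁻¹ ^ 2 * (-(v 1) * h0 + v 0 * h1)

lemma exists_conj_offDiag_eq_zero (M : Matrix (Fin 2) (Fin 2) ℂ) {x y : Fin 2} (hxy : x ≠ y) :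
    ∃ V ∈ Matrix.specialUnitaryGroup (Fin 2) ℂ, (Vᴴ * M * V) x y = 0 := by
  obtain ⟨rfl, rfl⟩ | ⟨rfl, rfl⟩ : (x = 1 ∧ y = 0) ∨ (x = 0 ∧ y = 1) := by omega
  · exact exists_triangular M
  · obtain ⟨V, hV, h⟩ := exists_triangular Mᴴ
    refine ⟨V, hV, ?_⟩
    have := congrArg star h
    rwa [← Matrix.conjTranspose_apply, star_zero, Matrix.conjTranspose_mul,
      Matrix.conjTranspose_mul, Matrix.conjTranspose_conjTranspose,
      Matrix.conjTranspose_conjTranspose, ← mul_assoc] at this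

/-- A triangular element of `SU(2)` is diagonal, since its off-diagonal entries have equal modulus.
-/
lemma exists_diagonalization {U : Matrix (Fin 2) (Fin 2) ℂ}
    (hU : U ∈ Matrix.specialUnitaryGroup (Fin 2) ℂ) :
    ∃ V ∈ Matrix.specialUnitaryGroup (Fin 2) ℂ, ∃ d : Fin 2 → ℂ, (∀ i, d i * star (d i) = 1) ∧
      Vᴴ * U * V = Matrix.diagonal d := by
  obtain ⟨V, hV, h⟩ := exists_triangular U
  obtain ⟨a, b, hab, he⟩ := exists_eq_suMatrix
    (mul_mem (mul_mem (conjTranspose_mem_specialUnitaryGroup hV) hU) hV)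
  have hb : b = 0 := by rw [he] at h; simpa [suMatrix] using h
  subst hb
  have ha : a * star a = 1 := by
    have : ‖a‖ ^ 2 = 1 := by simpa using hab
    rw [show a * star a = (‖a‖ : ℂ) ^ 2 from Complex.mul_conj' a]
    exact_mod_cast this
  refine ⟨V, hV, ![a, star a], fun i => ?_, ?_⟩
  · fin_cases i
    · exact ha
    · simpa [mul_comm] using ha
  · rw [he]
    ext i j
    fin_cases i <;> fin_cases j <;> simp [suMatrix]

end SpecialUnitary

/-! ### The local unitary group: compact, connected, closed under products and adjoints. -/

section Tensor

variable {n : ℕ}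

lemma tensor_mul (U V : Fin n → Matrix (Fin 2) (Fin 2) ℂ) :
    tensor U * tensor V = tensor (fun l => U l * V l) := by
  ext i j
  simp only [tensor, Matrix.mul_apply, Matrix.of_apply, Fintype.prod_sum, Finset.prod_mul_distrib]

lemma tensor_conjTranspose (U : Fin n → Matrix (Fin 2) (Fin 2) ℂ) :
    (tensor U)ᴴ = tensor (fun l => (U l)ᴴ) := by
  ext i j
  simp [tensor, Matrix.conjTranspose_apply]

lemma tensor_diagonal (d : Fin n → Fin 2 → ℂ) :
    tensor (fun l => Matrix.diagonal (d l)) = Matrix.diagonal (fun i => ∏ l, d l (i l)) := by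
  ext i j
  simp only [tensor, Matrix.of_apply, Matrix.diagonal_apply, Finset.prod_ite_zero,
    Finset.mem_univ, true_imp_iff, funext_iff]

lemma tensor_one : tensor (fun _ : Fin n => (1 : Matrix (Fin 2) (Fin 2) ℂ)) = 1 := by
  simp only [← Matrix.diagonal_one, tensor_diagonal, Finset.prod_const_one]

lemma trace_tensor (U : Fin n → Matrix (Fin 2) (Fin 2) ℂ) :
    (tensor U).trace = ∏ l, (U l).trace := by
  simp only [Matrix.trace, Matrix.diag, tensor, Matrix.of_apply, Fintype.prod_sum]

lemma continuous_tensor :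
    Continuous (tensor : (Fin n → Matrix (Fin 2) (Fin 2) ℂ) → QMat n) := by
  refine continuous_matrix fun i j => ?_
  simp only [tensor, Matrix.of_apply]
  fun_prop

lemma SUloc_eq_image :
    SUloc n = tensor '' Set.univ.pi fun _ : Fin n =>
      (Matrix.specialUnitaryGroup (Fin 2) ℂ : Set (Matrix (Fin 2) (Fin 2) ℂ)) := by
  ext K
  simp only [SUloc, Set.mem_ofPred_eq, Set.mem_image, Set.mem_univ_pi, SetLike.mem_coe, eq_comm]

lemma isCompact_SUloc : IsCompact (SUloc n) := by
  rw [SUloc_eq_image]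
  exact (isCompact_univ_pi fun _ => isCompact_specialUnitaryGroup).image continuous_tensor

lemma isPreconnected_SUloc : IsPreconnected (SUloc n) := by
  rw [SUloc_eq_image]
  exact (isPreconnected_univ_pi fun _ => isPreconnected_specialUnitaryGroup).image _
    continuous_tensor.continuousOn

lemma SUloc_one_mem : (1 : QMat n) ∈ SUloc n :=
  ⟨fun _ => 1, fun _ => one_mem _, tensor_one.symm⟩

lemma SUloc_mul_mem {K L : QMat n} (hK : K ∈ SUloc n) (hL : L ∈ SUloc n) : K * L ∈ SUloc n := by
  obtain ⟨U, hU, rfl⟩ := hK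
  obtain ⟨V, hV, rfl⟩ := hL
  exact ⟨_, fun l => mul_mem (hU l) (hV l), tensor_mul U V⟩

lemma SUloc_conjTranspose_mem {K : QMat n} (hK : K ∈ SUloc n) : Kᴴ ∈ SUloc n := by
  obtain ⟨U, hU, rfl⟩ := hK
  exact ⟨_, fun l => conjTranspose_mem_specialUnitaryGroup (hU l), tensor_conjTranspose U⟩

lemma SUloc_conjTranspose_mul_self {K : QMat n} (hK : K ∈ SUloc n) : Kᴴ * K = 1 := by
  obtain ⟨U, hU, rfl⟩ := hK
  simp only [tensor_conjTranspose, tensor_mul, conjTranspose_mul_self_of_mem (hU _), tensor_one]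

lemma SUloc_mul_conjTranspose_self {K : QMat n} (hK : K ∈ SUloc n) : K * Kᴴ = 1 := by
  simpa using SUloc_conjTranspose_mul_self (SUloc_conjTranspose_mem hK)

end Tensor

/-! ### General properties of local numerical ranges. -/

section Range

variable {n : ℕ}

lemma Wloc_eq_image (C A : QMat n) :
    Wloc C A = (fun K : QMat n => (Cᴴ * (K * A * Kᴴ)).trace) '' SUloc n := by
  ext z
  simp only [Wloc, Set.mem_ofPred_eq, Set.mem_image, eq_comm]

lemma continuous_trace_conj (C A : QMat n) :
    Continuous fun K : QMat n => (Cᴴ * (K * A * Kᴴ)).trace :=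
  (continuous_const.matrix_mul ((continuous_id.matrix_mul continuous_const).matrix_mul
    continuous_id.matrix_conjTranspose)).matrix_trace

lemma isCompact_Wloc (C A : QMat n) : IsCompact (Wloc C A) := by
  rw [Wloc_eq_image]
  exact isCompact_SUloc.image (continuous_trace_conj C A)

lemma isPreconnected_Wloc (C A : QMat n) : IsPreconnected (Wloc C A) := by
  rw [Wloc_eq_image]
  exact isPreconnected_SUloc.image _ (continuous_trace_conj C A).continuousOn

lemma trace_self_mem_Wloc (A : QMat n) : (Aᴴ * A).trace ∈ Wloc A A :=
  ⟨1, SUloc_one_mem, by simp⟩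

lemma Wloc_conj_subset {V : QMat n} (hV : V ∈ SUloc n) (C A : QMat n) :
    Wloc C (V * A * Vᴴ) ⊆ Wloc C A := by
  rintro z ⟨K, hK, rfl⟩
  refine ⟨K * V, SUloc_mul_mem hK hV, ?_⟩
  simp only [Matrix.conjTranspose_mul, mul_assoc]

lemma Wloc_conj {V : QMat n} (hV : V ∈ SUloc n) (C A : QMat n) :
    Wloc C (V * A * Vᴴ) = Wloc C A := by
  refine (Wloc_conj_subset hV C A).antisymm ?_
  have h := Wloc_conj_subset (SUloc_conjTranspose_mem hV) C (V * A * Vᴴ)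
  have e : Vᴴ * (V * A * Vᴴ) * Vᴴᴴ = (Vᴴ * V) * A * (Vᴴ * V) := by
    rw [Matrix.conjTranspose_conjTranspose]; noncomm_ring
  rwa [e, SUloc_conjTranspose_mul_self hV, one_mul, mul_one] at h

lemma mem_Wloc_smul (u : ℂ) {C A : QMat n} {z : ℂ} (hz : z ∈ Wloc C A) :
    u * z ∈ Wloc C (u • A) := by
  obtain ⟨K, hK, rfl⟩ := hz
  exact ⟨K, hK, by simp⟩

/-- The orbit of `A` contains `u • A` as soon as the range `Wloc A A` contains `u` times its
largest element. -/
lemma exists_conj_eq_smul {A : QMat n} {u : ℂ} (hu : ‖u‖ = 1)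
    (h : u * (Aᴴ * A).trace ∈ Wloc A A) : ∃ K ∈ SUloc n, K * A * Kᴴ = u • A := by
  obtain ⟨K, hK, e⟩ := h
  exact ⟨K, hK, eq_smul_of_trace_eq hu
    (conj_trace_self (SUloc_conjTranspose_mul_self hK) A) e.symm⟩

lemma IsCentredDisc.isRotationallySymmetric {S : Set ℂ} (hS : IsCentredDisc S) :
    IsRotationallySymmetric S := by
  obtain ⟨r, -, rfl⟩ := hS
  intro u hu z hz
  simpa [hu] using hz

/-- The moduli of points of `S` form an interval from `0` to the maximum, and rotations fill each
circle that `S` meets. -/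
lemma isCentredDisc_of_isCompact_of_isPreconnected {S : Set ℂ} (hc : IsCompact S)
    (hp : IsPreconnected S) (h0 : 0 ∈ S) (hr : IsRotationallySymmetric S) : IsCentredDisc S := by
  obtain ⟨w, hw, hmax⟩ := hc.exists_isMaxOn ⟨0, h0⟩ continuous_norm.continuousOn
  refine ⟨‖w‖, norm_nonneg w, Set.Subset.antisymm ?_ ?_⟩
  · intro z hz
    simpa using hmax hz
  · intro z hz
    rw [mem_closedBall_zero_iff] at hz
    have hmem : ‖z‖ ∈ norm '' S :=
      (hp.image norm continuous_norm.continuousOn).Icc_subset ⟨0, h0, norm_zero⟩ ⟨w, hw, rfl⟩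
        ⟨norm_nonneg z, hz⟩
    obtain ⟨y, hy, hyz⟩ := hmem
    by_cases hy0 : y = 0
    · have : z = 0 := by rw [← norm_eq_zero, ← hyz, hy0, norm_zero]
      rwa [this]
    · have := hr (z / y) (by rw [norm_div, hyz, div_self]; rwa [← hyz, norm_ne_zero_iff]) y hy
      rwa [div_mul_cancel₀ _ hy0] at this

end Range

/-! ### Consequences of sign reversal and of disc-shaped ranges. -/

section SignReversal

variable {n : ℕ}

/-- Hermiticity makes the range real and Cauchy–Schwarz bounds it. The identity and the
sign-reversing unitary attain the two endpoints; connectedness fills the gap. -/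
lemma Wloc_self_eq_Icc {H : QMat n} (hH : H.IsHermitian) (hs : LocallySignReversible H) :
    Wloc H H = Complex.ofReal '' Set.Icc (-frobNorm H ^ 2) (frobNorm H ^ 2) := by
  have htr : (Hᴴ * H).trace = ((frobNorm H ^ 2 : ℝ) : ℂ) := by
    rw [frobNorm_sq, ← Complex.re_add_im (Hᴴ * H).trace, trace_conjTranspose_mul_self_im]
    simp
  refine Set.Subset.antisymm ?_ ?_
  · rintro z ⟨K, hK, rfl⟩
    have him : (Hᴴ * (K * H * Kᴴ)).trace.im = 0 :=
      im_trace_eq_zero hH.conjTranspose (Matrix.isHermitian_mul_mul_conjTranspose K hH)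
    have hre := abs_le.mp
      (abs_re_trace_le (conj_trace_self (SUloc_conjTranspose_mul_self hK) H))
    rw [← frobNorm_sq] at hre
    exact ⟨_, hre, Complex.ext (by simp) (by simp [him])⟩
  · obtain ⟨K, hK, hKH⟩ := hs
    rintro _ ⟨x, hx, rfl⟩
    have hmem : x ∈ Complex.re '' Wloc H H := by
      refine ((isPreconnected_Wloc H H).image _ Complex.continuous_re.continuousOn).Icc_subset
        ⟨_, ⟨K, hK, rfl⟩, ?_⟩ ⟨_, trace_self_mem_Wloc H, ?_⟩ hx
      · simp only [hKH, mul_neg, Matrix.trace_neg, htr, Complex.neg_re, Complex.ofReal_re]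
      · rw [htr, Complex.ofReal_re]
    obtain ⟨z, hz, rfl⟩ := hmem
    convert hz
    obtain ⟨L, hL, rfl⟩ := hz
    have him : (Hᴴ * (L * H * Lᴴ)).trace.im = 0 :=
      im_trace_eq_zero hH.conjTranspose (Matrix.isHermitian_mul_mul_conjTranspose L hH)
    exact Complex.ext (by simp) (by simp [him])

lemma exists_signReversal_of_isCentredDisc {A : QMat n} (hA : IsCentredDisc (Wloc A A)) :
    ∃ K ∈ SUloc n, ∀ c : ℂ, K * (A + c • Aᴴ) * Kᴴ = -(A + c • Aᴴ) := by
  obtain ⟨K, hK, h⟩ := exists_conj_eq_smul (u := -1) (by simp)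
    (hA.isRotationallySymmetric _ (by simp) _ (trace_self_mem_Wloc A))
  rw [neg_one_smul] at h
  refine ⟨K, hK, fun c => ?_⟩
  have h' : K * Aᴴ * Kᴴ = -Aᴴ := by
    rw [← Matrix.conjTranspose_neg, ← h]
    simp [mul_assoc]
  rw [mul_add, add_mul, Matrix.mul_smul, Matrix.smul_mul, h, h', smul_neg, neg_add]

end SignReversal

/-! ### Off-diagonal matrix units have disc-shaped ranges. -/

section MatrixUnits

variable {n : ℕ}

lemma conj_diagonal_apply (d : Qubits n → ℂ) (A : QMat n) (i j : Qubits n) :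
    (Matrix.diagonal d * A * (Matrix.diagonal d)ᴴ) i j = d i * A i j * star (d j) := by
  rw [Matrix.diagonal_conjTranspose, Matrix.mul_diagonal, Matrix.diagonal_mul, Pi.star_apply]

lemma conj_single_apply (K : QMat n) (i j a b : Qubits n) (z : ℂ) :
    (K * Matrix.single i j z * Kᴴ) a b = K a i * z * star (K b j) := by
  rw [Matrix.mul_apply, Finset.sum_eq_single j, Matrix.mul_single_apply_same,
    Matrix.conjTranspose_apply]
  · intro k _ hk
    rw [Matrix.mul_single_apply_of_ne _ _ _ _ _ hk, zero_mul]
  · simp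

/-- A matrix unit off the diagonal is rotated by local phases. -/
lemma exists_conj_single_eq_smul {i j : Qubits n} (hij : i ≠ j) (z : ℂ) {u : ℂ} (hu : ‖u‖ = 1) :
    ∃ K ∈ SUloc n, K * Matrix.single i j z * Kᴴ = u • Matrix.single i j z := by
  obtain ⟨l, hl⟩ := Function.ne_iff.mp hij
  have hphase : ∃ d : Fin 2 → ℂ, Matrix.diagonal d ∈ Matrix.specialUnitaryGroup (Fin 2) ℂ ∧
      d (i l) * star (d (j l)) = u := by
    -- Determinant one forces the phases `w, w̄` on the two levels, whose relative phase is `w²`;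
    -- hence a square root of `u`.
    obtain ⟨w, hw⟩ := IsAlgClosed.exists_pow_nat_eq u (n := 2) two_pos
    have hw1 : ‖w‖ = 1 := by
      rw [← pow_eq_one_iff_of_nonneg (norm_nonneg w) two_ne_zero, ← norm_pow, hw, hu]
    have hmem : ∀ v : ℂ, ‖v‖ = 1 →
        Matrix.diagonal ![v, star v] ∈ Matrix.specialUnitaryGroup (Fin 2) ℂ := fun v hv => by
      convert suMatrix_mem (a := v) (b := 0) (by simp [hv]) using 1
      ext a b
      fin_cases a <;> fin_cases b <;> simp [suMatrix]
    obtain ⟨h0, h1⟩ | ⟨h0, h1⟩ : (i l = 0 ∧ j l = 1) ∨ (i l = 1 ∧ j l = 0) := by omega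
    · exact ⟨_, hmem w hw1, by simp [h0, h1, ← hw, sq]⟩
    · exact ⟨_, hmem (star w) (by simpa using hw1), by simp [h0, h1, ← hw, sq]⟩
  obtain ⟨d, hd, hdu⟩ := hphase
  let e : Fin n → Fin 2 → ℂ := Function.update (fun _ => 1) l d
  refine ⟨tensor fun k => Matrix.diagonal (e k), ⟨_, fun k => ?_, rfl⟩, ?_⟩
  · by_cases hk : k = l
    · subst hk; simpa [e] using hd
    · simp only [e, Function.update_of_ne hk, Matrix.diagonal_one']
      exact one_mem _
  · have hprod : ∀ x : Qubits n, ∏ k, e k (x k) = d (x l) := fun x => by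
      rw [Finset.prod_eq_single l]
      · simp [e]
      · intro k _ hk; simp [e, hk]
      · simp
    ext a b
    rw [tensor_diagonal, conj_diagonal_apply, hprod, hprod, Matrix.smul_apply, smul_eq_mul,
      Matrix.single_apply]
    split_ifs with h
    · rw [← h.1, ← h.2, ← hdu]; ring
    · simp

lemma isRotationallySymmetric_Wloc_single {i j : Qubits n} (hij : i ≠ j) (z : ℂ) (C : QMat n) :
    IsRotationallySymmetric (Wloc C (Matrix.single i j z)) := by
  intro u hu w hw
  obtain ⟨K, hK, h⟩ := exists_conj_single_eq_smul hij z hu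
  rw [← Wloc_conj hK, h]
  exact mem_Wloc_smul u hw

lemma tensor_update_one_apply (U : Matrix (Fin 2) (Fin 2) ℂ) (l : Fin n) (b i : Qubits n) :
    tensor (Function.update (fun _ => 1) l U) b i =
      if ∀ k, k ≠ l → b k = i k then U (b l) (i l) else 0 := by
  rw [tensor, Matrix.of_apply]
  split_ifs with h
  · rw [Finset.prod_eq_single l]
    · simp
    · intro k _ hk; simp [hk, h k hk]
    · simp
  · push Not at h
    obtain ⟨k, hk, hbk⟩ := h
    exact Finset.prod_eq_zero (Finset.mem_univ k) (by simp [hk, hbk])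

lemma sum_mul_tensor_update_one (U : Matrix (Fin 2) (Fin 2) ℂ) (l : Fin n) (i : Qubits n)
    (g : Qubits n → ℂ) :
    ∑ b, g b * tensor (Function.update (fun _ => 1) l U) b i =
      ∑ t, g (Function.update i l t) * U t (i l) := by
  refine (Fintype.sum_of_injective (Function.update i l) (Function.update_injective i l) _ _ ?_
    ?_).symm
  · intro b hb
    rw [tensor_update_one_apply, if_neg, mul_zero]
    intro h
    refine hb ⟨b l, ?_⟩
    ext k
    by_cases hk : k = l
    · subst hk; simp
    · simp [hk, h k hk]
  · intro t
    rw [tensor_update_one_apply, if_pos (fun k hk => by simp [hk])]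
    simp

/-- Acting on one qubit only, `K† C K` has the entries of a conjugated `2 × 2` matrix. -/
lemma conj_tensor_update_one_apply (U : Matrix (Fin 2) (Fin 2) ℂ) (l : Fin n) (C : QMat n)
    (i j : Qubits n) :
    ((tensor (Function.update (fun _ => 1) l U))ᴴ * C *
        tensor (Function.update (fun _ => 1) l U)) j i =
      (Uᴴ * Matrix.of (fun s t => C (Function.update j l s) (Function.update i l t)) * U)
        (j l) (i l) := by
  rw [Matrix.mul_apply, sum_mul_tensor_update_one, Matrix.mul_apply]
  refine Finset.sum_congr rfl fun t _ => ?_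
  congr 1
  rw [Matrix.mul_apply, Matrix.mul_apply]
  have h := congrArg star (sum_mul_tensor_update_one U l j
    fun b => star (C b (Function.update i l t)))
  simpa [mul_comm] using h

/-- Up to the factor `z`, the trace is one entry of `K† C† K`. At a qubit `l` where `i` and `j`
differ, it is an off-diagonal entry of a `2 × 2` block, which a unitary on that qubit alone can
annihilate. -/
lemma zero_mem_Wloc_single {i j : Qubits n} (hij : i ≠ j) (z : ℂ) (C : QMat n) :
    0 ∈ Wloc C (Matrix.single i j z) := by
  obtain ⟨l, hl⟩ := Function.ne_iff.mp hij
  obtain ⟨U, hU, h⟩ := exists_conj_offDiag_eq_zero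
    (Matrix.of fun s t => Cᴴ (Function.update j l s) (Function.update i l t)) (Ne.symm hl)
  rw [← conj_tensor_update_one_apply] at h
  refine ⟨tensor (Function.update (fun _ => 1) l U), ⟨_, fun k => ?_, rfl⟩, ?_⟩
  · by_cases hk : k = l
    · subst hk; simpa using hU
    · simp only [Function.update_of_ne hk]
      exact one_mem _
  · set K := tensor (Function.update (fun _ => 1) l U)
    have e : (Cᴴ * (K * Matrix.single i j z * Kᴴ)).trace =
        (Kᴴ * Cᴴ * K * Matrix.single i j z).trace := by
      rw [← mul_assoc, Matrix.trace_mul_comm]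
      simp only [mul_assoc]
    rw [e, Matrix.trace_mul_single, h]
    simp

lemma isCentredDisc_Wloc_single {i j : Qubits n} (hij : i ≠ j) (z : ℂ) (C : QMat n) :
    IsCentredDisc (Wloc C (Matrix.single i j z)) :=
  isCentredDisc_of_isCompact_of_isPreconnected (isCompact_Wloc _ _) (isPreconnected_Wloc _ _)
    (zero_mem_Wloc_single hij z C) (isRotationallySymmetric_Wloc_single hij z C)

/-- The phases `s`, `t` are needed because a flip of determinant one carries a sign. -/
lemma exists_swap (x y : Fin 2) : ∃ F ∈ Matrix.specialUnitaryGroup (Fin 2) ℂ, ∃ s t : ℂ,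
    ‖s‖ = 1 ∧ ‖t‖ = 1 ∧ (∀ a, F a x = if a = y then s else 0) ∧
      ∀ a, F a y = if a = x then t else 0 := by
  by_cases hxy : x = y
  · subst hxy
    exact ⟨1, one_mem _, 1, 1, by simp, by simp, fun a => Matrix.one_apply,
      fun a => Matrix.one_apply⟩
  · refine ⟨suMatrix 0 1, suMatrix_mem (by simp), suMatrix 0 1 y x, suMatrix 0 1 x y, ?_⟩
    obtain ⟨rfl, rfl⟩ | ⟨rfl, rfl⟩ : (x = 0 ∧ y = 1) ∨ (x = 1 ∧ y = 0) := by omega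
    all_goals simp [suMatrix, Fin.forall_fin_two]

/-- Flip the qubits where `i` and `j` differ and leave the others alone; the flip signs collect into
`u`. -/
lemma exists_conj_single_eq_swap (i j : Qubits n) (z : ℂ) :
    ∃ K ∈ SUloc n, ∃ u : ℂ, ‖u‖ = 1 ∧
      K * Matrix.single i j z * Kᴴ = Matrix.single j i (u * z) := by
  choose F hF s t hs ht hFs hFt using fun l => exists_swap (i l) (j l)
  refine ⟨tensor F, ⟨F, hF, rfl⟩, (∏ l, s l) * star (∏ l, t l), by simp [hs, ht], ?_⟩
  ext a b
  rw [conj_single_apply, Matrix.single_apply]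
  simp only [tensor, Matrix.of_apply, hFs, hFt, Finset.prod_ite_zero, Finset.mem_univ,
    true_imp_iff, eq_comm (a := j), eq_comm (a := i)]
  simp only [← funext_iff (f := a) (g := j), ← funext_iff (f := b) (g := i)]
  by_cases ha : a = j <;> by_cases hb : b = i <;> simp [ha, hb]
  ring

lemma Wloc_single_conjTranspose {i j : Qubits n} (hij : i ≠ j) (z : ℂ) (C : QMat n) :
    Wloc C (Matrix.single i j z) = Wloc C (Matrix.single i j z)ᴴ := by
  obtain ⟨K, hK, u, hu, h⟩ := exists_conj_single_eq_swap i j z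
  rw [← Wloc_conj hK, h, Matrix.conjTranspose_single]
  -- The swapped unit and the adjoint have coefficients of equal modulus, so a local phase `v`
  -- matches them.
  obtain ⟨v, hv, hvz⟩ : ∃ v : ℂ, ‖v‖ = 1 ∧ v * (u * z) = star z := by
    by_cases hz : z = 0
    · exact ⟨1, by simp, by simp [hz]⟩
    · have hu0 : u ≠ 0 := by rintro rfl; simp at hu
      exact ⟨star z / (u * z), by simp [hu, hz], by field_simp⟩
  obtain ⟨L, hL, h'⟩ := exists_conj_single_eq_smul hij.symm (u * z) hv
  rw [← Wloc_conj hL, h', Matrix.smul_single, smul_eq_mul, hvz]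

end MatrixUnits

/-! ### Splitting a sign-reversible Hermitian matrix into pairs. -/

section Decomposition

variable {n : ℕ}

/-- A local unitary is diagonal in a local orthonormal basis. -/
lemma exists_local_diagonalization {K : QMat n} (hK : K ∈ SUloc n) :
    ∃ V ∈ SUloc n, ∃ d : Qubits n → ℂ, (∀ i, d i * star (d i) = 1) ∧
      Vᴴ * K * V = Matrix.diagonal d := by
  obtain ⟨U, hU, rfl⟩ := hK
  choose V hV d hd h using fun l => exists_diagonalization (hU l)
  refine ⟨tensor V, ⟨V, hV, rfl⟩, fun i => ∏ l, d l (i l), fun i => ?_, ?_⟩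
  · rw [star_prod, ← Finset.prod_mul_distrib]
    simp only [hd, Finset.prod_const_one]
  · simp only [tensor_conjTranspose, tensor_mul, h, tensor_diagonal]

/-- In a local eigenbasis of the reversing unitary, conjugation multiplies the `i`-th diagonal entry
by `|dᵢ|² = 1`, yet must negate it. -/
lemma exists_conj_diag_eq_zero {H : QMat n} (hs : LocallySignReversible H) :
    ∃ V ∈ SUloc n, ∀ i, (Vᴴ * H * V) i i = 0 := by
  obtain ⟨K, hK, hKH⟩ := hs
  obtain ⟨V, hV, d, hd, h⟩ := exists_local_diagonalization hK
  refine ⟨V, hV, fun i => ?_⟩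
  have hVV := SUloc_mul_conjTranspose_self hV
  have e : Matrix.diagonal d * (Vᴴ * H * V) * (Matrix.diagonal d)ᴴ = -(Vᴴ * H * V) := by
    rw [← h]
    simp only [Matrix.conjTranspose_mul, Matrix.conjTranspose_conjTranspose]
    calc Vᴴ * K * V * (Vᴴ * H * V) * (Vᴴ * (Kᴴ * V))
        = Vᴴ * (K * (V * Vᴴ) * H * (V * Vᴴ) * Kᴴ) * V := by noncomm_ring
      _ = -(Vᴴ * H * V) := by
        rw [hVV, mul_one, mul_one, hKH, mul_neg, neg_mul]
  have hi := congrFun (congrFun e i) i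
  rw [conj_diagonal_apply, Matrix.neg_apply] at hi
  linear_combination (1 / 2 : ℂ) * hi - (1 / 2 : ℂ) * (Vᴴ * H * V) i i * hd i

/-- A Hermitian matrix with zero diagonal is the sum over the pairs above the diagonal, for any
ordering of the index set. -/
lemma eq_sum_single_add_conjTranspose {ι : Type*} [Fintype ι] [DecidableEq ι] {N : ℕ}
    (e : ι ≃ Fin N) {H : Matrix ι ι ℂ} (hH : H.IsHermitian) (h0 : ∀ i, H i i = 0) :
    H = ∑ p : {p : ι × ι // e p.1 < e p.2},
      (Matrix.single p.1.1 p.1.2 (H p.1.1 p.1.2) +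
        (Matrix.single p.1.1 p.1.2 (H p.1.1 p.1.2))ᴴ) := by
  ext a b
  simp only [Matrix.sum_apply, Matrix.add_apply, Matrix.conjTranspose_single, Matrix.single_apply]
  rcases lt_trichotomy (e a) (e b) with hab | hab | hab
  · rw [Finset.sum_eq_single ⟨(a, b), hab⟩]
    · have hne : b ≠ a := by rintro rfl; exact lt_irrefl _ hab
      simp [hne]
    · rintro ⟨⟨c, d⟩, hcd⟩ - hne
      rw [if_neg, if_neg, add_zero]
      · rintro ⟨rfl, rfl⟩; exact lt_asymm hab hcd
      · rintro ⟨rfl, rfl⟩; exact hne rfl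
    · simp
  · obtain rfl := e.injective hab
    rw [h0, Finset.sum_eq_zero]
    rintro ⟨⟨c, d⟩, hcd⟩ -
    have hne : c ≠ d := by rintro rfl; exact lt_irrefl _ hcd
    rw [if_neg, if_neg, add_zero]
    · exact fun h => hne (h.2.trans h.1.symm)
    · exact fun h => hne (h.1.trans h.2.symm)
  · rw [Finset.sum_eq_single ⟨(b, a), hab⟩]
    · have hne : b ≠ a := by rintro rfl; exact lt_irrefl _ hab
      simp [hne, hH.apply]
    · rintro ⟨⟨c, d⟩, hcd⟩ - hne
      rw [if_neg, if_neg, add_zero]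
      · rintro ⟨rfl, rfl⟩; exact hne rfl
      · rintro ⟨rfl, rfl⟩; exact lt_asymm hab hcd
    · simp

/-- Ordered pairs inject into the unordered pairs of distinct elements. -/
lemma card_ordered_pairs_le {ι : Type*} [Fintype ι] [DecidableEq ι] {N : ℕ} (e : ι ≃ Fin N) :
    Fintype.card {p : ι × ι // e p.1 < e p.2} ≤ N.choose 2 := by
  have hN : Fintype.card ι = N := by simpa using Fintype.card_congr e
  have hcard := Sym2.card_subtype_not_diag (α := ι)
  rw [hN] at hcard
  rw [← hcard]
  refine Fintype.card_le_of_injective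
    (fun p => ⟨s(p.1.1, p.1.2), fun h => p.2.ne (congrArg e (Sym2.mk_isDiag_iff.mp h))⟩) ?_
  rintro ⟨⟨a, b⟩, hab⟩ ⟨⟨c, d⟩, hcd⟩ h
  simp only [Subtype.mk.injEq, Sym2.eq_iff] at h
  obtain ⟨rfl, rfl⟩ | ⟨rfl, rfl⟩ := h
  · rfl
  · exact absurd hab (lt_asymm hcd)

lemma exists_disc_decomposition {H : QMat n} (hH : H.IsHermitian)
    (hs : LocallySignReversible H) :
    ∃ m : ℕ, m ≤ (2 ^ n).choose 2 ∧ ∃ P : Fin m → QMat n,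
      H = ∑ l, (P l + (P l)ᴴ) ∧
      ∀ (l : Fin m) (C : QMat n), Wloc C (P l) = Wloc C (P l)ᴴ ∧
        IsRotationallySymmetric (Wloc C (P l)) ∧ IsCentredDisc (Wloc C (P l)) := by
  obtain ⟨V, hV, h0⟩ := exists_conj_diag_eq_zero hs
  have hVV := SUloc_mul_conjTranspose_self hV
  have hH' : (Vᴴ * H * V).IsHermitian := Matrix.isHermitian_conjTranspose_mul_mul V hH
  have e : Qubits n ≃ Fin (2 ^ n) := Fintype.equivFinOfCardEq (by simp)
  have hsum := eq_sum_single_add_conjTranspose e hH' h0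
  set H' := Vᴴ * H * V with hH'def
  let S := {p : Qubits n × Qubits n // e p.1 < e p.2}
  let f := (Fintype.equivFin S).symm
  let Q : S → QMat n := fun p => Matrix.single p.1.1 p.1.2 (H' p.1.1 p.1.2)
  refine ⟨Fintype.card S, card_ordered_pairs_le e, fun l => V * Q (f l) * Vᴴ, ?_, ?_⟩
  · have hadj : ∀ A : QMat n, (V * A * Vᴴ)ᴴ = V * Aᴴ * Vᴴ := fun A => by simp [mul_assoc]
    calc H = (V * Vᴴ) * H * (V * Vᴴ) := by rw [hVV, one_mul, mul_one]
      _ = V * H' * Vᴴ := by rw [hH'def]; noncomm_ring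
      _ = V * (∑ p : S, (Q p + (Q p)ᴴ)) * Vᴴ := by rw [← hsum]
      _ = ∑ p : S, (V * Q p * Vᴴ + (V * Q p * Vᴴ)ᴴ) := by
        simp only [Finset.mul_sum, Finset.sum_mul, hadj, mul_add, add_mul]
      _ = _ := (Equiv.sum_comp f fun p => V * Q p * Vᴴ + (V * Q p * Vᴴ)ᴴ).symm
  · intro l C
    have hne : (f l).1.1 ≠ (f l).1.2 := fun h => (f l).2.ne (congrArg e h)
    have hadj : (V * Q (f l) * Vᴴ)ᴴ = V * (Q (f l))ᴴ * Vᴴ := by simp [mul_assoc]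
    -- Returning from the eigenbasis by the local `V` changes no range.
    rw [hadj, Wloc_conj hV, Wloc_conj hV]
    exact ⟨Wloc_single_conjTranspose hne _ C, isRotationallySymmetric_Wloc_single hne _ C,
      isCentredDisc_Wloc_single hne _ C⟩

end Decomposition

/-! ### A three-qubit Hamiltonian that is not a single pair. -/

section Counterexample

/-- The Pauli matrix `X`, or the identity. -/
def pauliXPow (b : Bool) : Matrix (Fin 2) (Fin 2) ℂ := if b then !![0, 1; 1, 0] else 1

lemma pauliXPow_isHermitian (b : Bool) : (pauliXPow b).IsHermitian := by
  cases b
  · exact Matrix.isHermitian_one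
  · ext i j
    fin_cases i <;> fin_cases j <;> simp [pauliXPow]

/-- The Pauli string with `X` at the qubits where `s` is true. -/
def pauliXString (s : Fin 3 → Bool) : QMat 3 := tensor fun l => pauliXPow (s l)

lemma pauliXString_isHermitian (s : Fin 3 → Bool) : (pauliXString s).IsHermitian := by
  rw [Matrix.IsHermitian, pauliXString, tensor_conjTranspose]
  simp only [(pauliXPow_isHermitian _).eq]

/-- The indicator of a single qubit. -/
def oneSite (l : Fin 3) : Fin 3 → Bool := fun k => decide (k = l)

/-- `X₁ + X₂ + X₃ + X₁X₂X₃`. -/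
def threeQubit : QMat 3 := ∑ l, pauliXString (oneSite l) + pauliXString fun _ => true

lemma threeQubit_isHermitian : threeQubit.IsHermitian := by
  rw [Matrix.IsHermitian, threeQubit, Matrix.conjTranspose_add, Matrix.conjTranspose_sum]
  simp only [(pauliXString_isHermitian _).eq]

/-- Conjugation by `diag(i, -i)` negates `X`. Applied to every qubit it negates each Pauli string
with an odd number of `X` factors, hence every term here. -/
lemma threeQubit_locallySignReversible : LocallySignReversible threeQubit := by
  let Z : Matrix (Fin 2) (Fin 2) ℂ := suMatrix Complex.I 0
  have hZ : Z ∈ Matrix.specialUnitaryGroup (Fin 2) ℂ := suMatrix_mem (by simp)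
  have hX : Z * pauliXPow true * Zᴴ = -pauliXPow true := by
    ext i j
    fin_cases i <;> fin_cases j <;>
      simp [Z, suMatrix, pauliXPow, Matrix.mul_apply, Fin.sum_univ_two]
  have h1 : Z * pauliXPow false * Zᴴ = pauliXPow false := by
    simp only [pauliXPow, Bool.false_eq_true, if_false, mul_one]
    exact Matrix.mem_unitaryGroup_iff.mp (Matrix.mem_specialUnitaryGroup_iff.mp hZ).1
  refine ⟨tensor fun _ => Z, ⟨_, fun _ => hZ, rfl⟩, ?_⟩
  have hstr : ∀ s : Fin 3 → Bool, (s 0 ^^ s 1 ^^ s 2) = true →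
      tensor (fun _ => Z) * pauliXString s * (tensor fun _ => Z)ᴴ = -pauliXString s := by
    intro s hs
    have hl : ∀ b, Z * pauliXPow b * Zᴴ = (if b then (-1 : ℂ) else 1) • pauliXPow b := by
      rintro (_ | _)
      · simp [h1]
      · simp [hX]
    rw [pauliXString, tensor_conjTranspose, tensor_mul, tensor_mul]
    simp only [hl]
    ext i j
    simp only [tensor, Matrix.of_apply, Matrix.smul_apply, smul_eq_mul, Finset.prod_mul_distrib,
      Matrix.neg_apply]
    rw [Fin.prod_univ_three]
    revert hs
    cases s 0 <;> cases s 1 <;> cases s 2 <;> simp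
  rw [threeQubit, mul_add, add_mul, Finset.mul_sum, Finset.sum_mul, neg_add,
    ← Finset.sum_neg_distrib]
  congr 1
  · refine Finset.sum_congr rfl fun l _ => hstr _ ?_
    fin_cases l <;> decide
  · exact hstr _ rfl

lemma trace_pauliXString_mul_conj (s t : Fin 3 → Bool) (U : Fin 3 → Matrix (Fin 2) (Fin 2) ℂ) :
    (pauliXString s * (tensor U * pauliXString t * (tensor U)ᴴ)).trace =
      ∏ l, (pauliXPow (s l) * (U l * pauliXPow (t l) * (U l)ᴴ)).trace := by
  simp only [pauliXString, tensor_conjTranspose, tensor_mul, trace_tensor]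

/-- The correlation of `X` with its conjugate by `U`. -/
noncomputable def correlation (U : Matrix (Fin 2) (Fin 2) ℂ) : ℝ :=
  (pauliXPow true * (U * pauliXPow true * Uᴴ)).trace.re

lemma correlation_one : correlation 1 = 2 := by
  simp [correlation, pauliXPow, Matrix.trace_fin_two]
  norm_num

lemma abs_correlation_le {U : Matrix (Fin 2) (Fin 2) ℂ} (hU : Uᴴ * U = 1) :
    |correlation U| ≤ 2 := by
  have h := abs_re_trace_le (conj_trace_self hU (pauliXPow true))
  have h1 := correlation_one
  rw [(pauliXPow_isHermitian true).eq] at h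
  rw [correlation, Matrix.conjTranspose_one, one_mul, mul_one] at h1
  exact h.trans_eq h1

/-- Traces of strings factor over qubits, and any qubit where exactly one string has an `X`
contributes `0`. Only the matching term survives; the factor `4` comes from the identities on the
other two qubits. -/
lemma correlations_threeQubit {U : Fin 3 → Matrix (Fin 2) (Fin 2) ℂ}
    (hU : ∀ l, U l ∈ Matrix.specialUnitaryGroup (Fin 2) ℂ) :
    (∀ l, (pauliXString (oneSite l) * (tensor U * threeQubit * (tensor U)ᴴ)).trace =
        4 * (correlation (U l) : ℂ)) ∧
      ((pauliXString fun _ => true) * (tensor U * threeQubit * (tensor U)ᴴ)).trace =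
        ∏ l, (correlation (U l) : ℂ) := by
  have hUU : ∀ l, (U l)ᴴ * U l = 1 := fun l => conjTranspose_mul_self_of_mem (hU l)
  have hUU' : ∀ l, U l * (U l)ᴴ = 1 := fun l => by
    simpa using conjTranspose_mul_self_of_mem (conjTranspose_mem_specialUnitaryGroup (hU l))
  have h11 : ∀ l, (pauliXPow true * (U l * pauliXPow true * (U l)ᴴ)).trace = correlation (U l) :=
    fun l =>
    Complex.ext (by simp [correlation]) (by
      rw [Complex.ofReal_im]
      exact im_trace_eq_zero (pauliXPow_isHermitian _)
        (Matrix.isHermitian_mul_mul_conjTranspose _ (pauliXPow_isHermitian _)))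
  have hX0 : (pauliXPow true).trace = 0 := by simp [pauliXPow, Matrix.trace_fin_two]
  have h10 : ∀ l, (pauliXPow true * (U l * pauliXPow false * (U l)ᴴ)).trace = 0 := fun l => by
    rw [show pauliXPow false = 1 from rfl, mul_one, hUU', mul_one, hX0]
  have h01 : ∀ l, (pauliXPow false * (U l * pauliXPow true * (U l)ᴴ)).trace = 0 := fun l => by
    rw [show pauliXPow false = 1 from rfl, one_mul, Matrix.trace_mul_comm, ← mul_assoc, hUU,
      one_mul, hX0]
  have h00 : ∀ l, (pauliXPow false * (U l * pauliXPow false * (U l)ᴴ)).trace = 2 := fun l => by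
    rw [show pauliXPow false = 1 from rfl, one_mul, mul_one, hUU']
    simp
  refine ⟨fun l => ?_, ?_⟩
  · simp only [threeQubit, mul_add, add_mul, Matrix.trace_add, trace_pauliXString_mul_conj,
      Fin.sum_univ_three, Fin.prod_univ_three]
    fin_cases l <;> simp [oneSite, h00, h01, h10, h11] <;>
      first | ring1 | norm_num
  · simp only [threeQubit, mul_add, add_mul, Matrix.trace_add, trace_pauliXString_mul_conj,
      Fin.sum_univ_three, Fin.prod_univ_three]
    simp [oneSite, h10, h11]

lemma trace_mul_rotated {A P : QMat 3} (hA : A.IsHermitian) (u : ℂ) :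
    (A * (u • P + star u • Pᴴ)).trace = ((2 * (u * (A * P).trace).re : ℝ) : ℂ) := by
  have h : (A * Pᴴ).trace = star (A * P).trace := by
    rw [← Matrix.trace_conjTranspose, Matrix.conjTranspose_mul, hA.eq, Matrix.trace_mul_comm]
  rw [mul_add, Matrix.mul_smul, Matrix.mul_smul, Matrix.trace_add, Matrix.trace_smul,
    Matrix.trace_smul, h, smul_eq_mul, smul_eq_mul, ← star_mul', ← Complex.add_conj]
  rfl

/-- The choice `C = P` already suffices for the obstruction. -/
lemma threeQubit_not_decomposable :
    ¬ ∃ P : QMat 3, threeQubit = P + Pᴴ ∧ IsRotationallySymmetric (Wloc P P) := by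
  rintro ⟨P, hP, hrot⟩
  set p : Fin 3 → ℂ := fun l => (pauliXString (oneSite l) * P).trace
  set q : ℂ := ((pauliXString fun _ => true) * P).trace
  have hcorr : ∀ (u : ℂ) (U : Fin 3 → Matrix (Fin 2) (Fin 2) ℂ),
      (∀ l, U l ∈ Matrix.specialUnitaryGroup (Fin 2) ℂ) →
      tensor U * P * (tensor U)ᴴ = u • P →
      (∀ l, (u * p l).re = 2 * correlation (U l)) ∧
        2 * (u * q).re = ∏ l, correlation (U l) := by
    intro u U hU h
    have hH : tensor U * threeQubit * (tensor U)ᴴ = u • P + star u • Pᴴ := by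
      rw [hP, mul_add, add_mul, h, ← Matrix.conjTranspose_smul, ← h]
      simp [mul_assoc]
    obtain ⟨h1, h3⟩ := correlations_threeQubit hU
    rw [hH, trace_mul_rotated (pauliXString_isHermitian _)] at h3
    refine ⟨fun l => ?_, by exact_mod_cast h3⟩
    have h := h1 l
    rw [hH, trace_mul_rotated (pauliXString_isHermitian _)] at h
    have h' : 2 * (u * p l).re = 4 * correlation (U l) := by exact_mod_cast h
    linarith
  have hrot' : ∀ u : ℂ, ‖u‖ = 1 → ∃ w : Fin 3 → ℝ, (∀ l, |w l| ≤ 2) ∧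
      (∀ l, (u * p l).re = 2 * w l) ∧ 2 * (u * q).re = ∏ l, w l := by
    intro u hu
    obtain ⟨_, ⟨U, hU, rfl⟩, h⟩ := exists_conj_eq_smul hu (hrot u hu _ (trace_self_mem_Wloc P))
    exact ⟨_, fun l => abs_correlation_le (conjTranspose_mul_self_of_mem (hU l)), hcorr u U hU h⟩
  obtain ⟨hp, hq⟩ := hcorr 1 (fun _ => 1) (fun _ => one_mem _) (by simp [tensor_one])
  simp only [one_mul, correlation_one, Fin.prod_univ_three] at hp hq
  -- Rotating `p l` onto the positive axis shows `|p l| ≤ 4`, while `Re (p l) = 4` from `u = 1`;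
  -- hence `p l` is real.
  have hpim : ∀ l, (p l).im = 0 := by
    intro l
    have hp0 : p l ≠ 0 := by
      intro h
      have := hp l
      norm_num [h] at this
    have hn : ‖p l‖ ≠ 0 := norm_ne_zero_iff.mpr hp0
    obtain ⟨w, hw, h1, -⟩ := hrot' (star (p l) / ‖p l‖) (by simp [hn])
    have hle : ‖p l‖ ≤ 4 := by
      have e : star (p l) / ‖p l‖ * p l = (‖p l‖ : ℂ) := by
        have hn' : (‖p l‖ : ℂ) ≠ 0 := by exact_mod_cast hn
        have := Complex.conj_mul' (p l)
        rw [div_mul_eq_mul_div, div_eq_iff hn', ← sq]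
        exact this
      have h := h1 l
      rw [e, Complex.ofReal_re] at h
      linarith [(abs_le.mp (hw l)).2]
    have hsq : ‖p l‖ ^ 2 = (p l).re ^ 2 + (p l).im ^ 2 := by
      rw [← Complex.normSq_eq_norm_sq, Complex.normSq_apply]; ring
    rw [hp l] at hsq
    have : (p l).im ^ 2 ≤ 0 := by nlinarith [norm_nonneg (p l)]
    exact pow_eq_zero_iff two_ne_zero |>.mp (le_antisymm this (sq_nonneg _))
  -- With `p l = 4`, each correlation is `2 Re u`, and the three-qubit identity becomes cubic in `Re
  -- u`.
  have hcube : ∀ u : ℂ, ‖u‖ = 1 → (u * q).re = 4 * u.re ^ 3 := by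
    intro u hu
    obtain ⟨w, -, h1, h3⟩ := hrot' u hu
    have hw : ∀ l, w l = 2 * u.re := fun l => by
      have := h1 l
      rw [Complex.mul_re, hp l, hpim l] at this
      linarith
    simp only [hw, Fin.prod_univ_three] at h3
    linarith
  have hqim : q.im = 0 := by simpa using hcube Complex.I (by simp)
  -- `u = i` has made `q` real, and `u = 1` gave `Re q = 4`, so `Re u = (Re u)³` for every unit `u`;
  -- any point with `Re u ∉ {0, 1, -1}` refutes this, here a rational one.
  have h := hcube ⟨3 / 5, 4 / 5⟩ (by
    rw [Complex.norm_def, Complex.normSq_mk]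
    norm_num)
  rw [Complex.mul_re, hqim] at h
  norm_num at h
  linarith

end Counterexample

end LocalNumericalRange

theorem mainTheorem1 :
    -- (1) discs give sign-reversibility of all combinations, and a symmetric interval
    (∀ (n : ℕ) (A : LocalNumericalRange.QMat n),
      (∀ C : LocalNumericalRange.QMat n,
        LocalNumericalRange.IsCentredDisc (LocalNumericalRange.Wloc C A) ∧
        LocalNumericalRange.IsCentredDisc (LocalNumericalRange.Wloc C A.conjTranspose)) →
      (∃ K ∈ LocalNumericalRange.SUloc n, ∀ c : ℂ,
        K * (A + c • A.conjTranspose) * K.conjTranspose = -(A + c • A.conjTranspose)) ∧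
      LocalNumericalRange.LocallySignReversible (A + A.conjTranspose) ∧
      LocalNumericalRange.Wloc (A + A.conjTranspose) (A + A.conjTranspose) =
        Complex.ofReal '' Set.Icc
          (-LocalNumericalRange.frobNorm (A + A.conjTranspose) ^ 2)
          (LocalNumericalRange.frobNorm (A + A.conjTranspose) ^ 2)) ∧
    -- (2) the converse fails: one pair is not always enough
    (∃ (n : ℕ) (H : LocalNumericalRange.QMat n),
      H.IsHermitian ∧ LocalNumericalRange.LocallySignReversible H ∧
      ¬ ∃ P : LocalNumericalRange.QMat n, H = P + P.conjTranspose ∧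
        ∀ C : LocalNumericalRange.QMat n,
          LocalNumericalRange.IsRotationallySymmetric (LocalNumericalRange.Wloc C P) ∧
          LocalNumericalRange.IsRotationallySymmetric
            (LocalNumericalRange.Wloc C P.conjTranspose)) ∧
    -- (3) at most `2 ^ n` choose `2` pairs are always enough
    (∀ (n : ℕ) (H : LocalNumericalRange.QMat n),
      H.IsHermitian → LocalNumericalRange.LocallySignReversible H →
      ∃ m : ℕ, m ≤ (2 ^ n).choose 2 ∧ ∃ P : Fin m → LocalNumericalRange.QMat n,
        H = ∑ l, (P l + (P l).conjTranspose) ∧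
        ∀ (l : Fin m) (C : LocalNumericalRange.QMat n),
          LocalNumericalRange.Wloc C (P l) =
            LocalNumericalRange.Wloc C (P l).conjTranspose ∧
          LocalNumericalRange.IsRotationallySymmetric (LocalNumericalRange.Wloc C (P l)) ∧
          LocalNumericalRange.IsCentredDisc (LocalNumericalRange.Wloc C (P l))) := by
  refine ⟨fun n A hA => ?_, ?_, fun n H hH hs =>
    LocalNumericalRange.exists_disc_decomposition hH hs⟩
  · obtain ⟨K, hK, h⟩ := LocalNumericalRange.exists_signReversal_of_isCentredDisc (hA A).1
    have hs : LocalNumericalRange.LocallySignReversible (A + Aᴴ) :=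
      ⟨K, hK, by simpa using h 1⟩
    exact ⟨⟨K, hK, h⟩, hs,
      LocalNumericalRange.Wloc_self_eq_Icc (Matrix.isHermitian_add_transpose_self A) hs⟩
  · refine ⟨3, LocalNumericalRange.threeQubit, LocalNumericalRange.threeQubit_isHermitian,
      LocalNumericalRange.threeQubit_locallySignReversible, ?_⟩
    rintro ⟨P, hP, hC⟩
    exact LocalNumericalRange.threeQubit_not_decomposable ⟨P, hP, (hC P).1⟩
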